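/- Let $K$ be a field, $n\ge 0$, and let $S,S'\subset\mathbb R^n$ be finite sets with maps ("sampled maps") $h\colon S\to\mathbb R^n$ and $h'\colon S'\to\mathbb R^n$. Equip $\mathbb R^n$ with the Euclidean metric and $\mathbb R^n\times\mathbb R^n$ with the metric $d((x_1,y_1),(x_2,y_2))=\max\{\|x_1-x_2\|,\|y_1-y_2\|\}$. Let $\mathrm{Gr}(h)=\{(s,h(s)) : s\in S\}$, and for a subset $U$ of $\mathbb R^n$ or of $\mathbb R^n\times\mathbb R^n$ and $r\in\mathbb R$ let $U_r=\{x : 0\le r,\ \inf_{u\in U}d(x,u)\le r\}$ (empty for $r<0$; $\inf\emptyset=\infty$). Let $H$ be singular homology with coefficients in $K$, either in a fixed degree $k\ge 0$ or the direct sum over all degrees. The two coordinate projections of $\mathbb R^n\times\mathbb R^n$ and the inclusions of sublevel sets make $r\mapsto (HS_r\leftarrow H\mathrm{Gr}(h)_r\to Hh(S)_r)$ a functor from the poset $\mathbb R$ to the category of representations over $K$ of the quiver $A_3(bf)\colon 1\leftarrow 2\to 3$. For every $r$ choose an isomorphism of this representation with a direct sum $\bigoplus_{1\le b\le d\le 3}\mathbb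 I[b,d]^{m^r_{b,d}}$ of interval representations ($K$ at the vertices $b,\dots,d$ with identity maps between them, $0$ elsewhere). Let $M^h$ be the $\mathbb R$-persistence module with $M^h_r=K^{m^r_{1,3}}$ whose transition map from $r$ to $s$ $(r\le s)$ is the $([1,3],[1,3])$-block of the induced morphism between the decomposed representations, $\mathbb I[1,3]^m$ being identified with $K^m$. Define $M^{h'}$ in the same way. For $\mathbb R$-persistence modules $M,N$ and $\delta\ge 0$ let $M(\delta)_t=M_{t+\delta}$; $M$ and $N$ are $\delta$-interleaved if there are morphisms $f\colon M\to N(\delta)$ and $g\colon N\to M(\delta)$ such that $g(\delta)\circ f$ and $f(\delta)\circ g$ are the transition morphisms $M\to M(2\delta)$ and $N\to N(2\delta)$; and $d_I(M,N)\in[0,\infty]$ is the infimum of all $\delta\ge 0$ such that $M$ and $N$ are $\delta$-interleaved. Then, for all choices of the interval decompositions, $$d_I(M^h,M^{h'})\ \le\ d_H(\mathrm{Gr}(h),\mathrm{Gr}(h')),$$ where $d_H\in[0,\infty]$ is the Hausdorff distance for the metric $d$ on $\mathbb R^n\times\mathbb R^n$. -/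

import Mathlib

open CategoryTheory Limits
open scoped ENNReal NNReal

universe u

namespace SampledMap

/-! ### Representations of the quiver `A₃(bf) : 1 ← 2 → 3` -/

/-- The category of representations over `K` of the quiver `1 ← 2 → 3`.  In `WalkingSpan` the
vertices `1, 2, 3` are called `left`, `zero`, `right`. -/
abbrev A3Rep (K : Type u) [Field K] : Type (u + 1) := WalkingSpan ⥤ ModuleCat.{u} K

/-- A morphism of diagrams `(Y ← X → Z) ⟶ (Y' ← X' → Z')`, given by its three components. -/
def spanMap {C : Type*} [Category C] {X Y Z X' Y' Z' : C} {f : X ⟶ Y} {g : X ⟶ Z}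
    {f' : X' ⟶ Y'} {g' : X' ⟶ Z'} (b : Y ⟶ Y') (a : X ⟶ X') (c : Z ⟶ Z')
    (hf : f ≫ b = a ≫ f') (hg : g ≫ c = a ≫ g') : span f g ⟶ span f' g' where
  app j := match j with
    | WalkingSpan.left => b
    | WalkingSpan.zero => a
    | WalkingSpan.right => c
  naturality := by
    rintro _ _ (_ | (_ | _))
    · simp only [WidePushoutShape.hom_id, CategoryTheory.Functor.map_id, Category.id_comp,
        Category.comp_id]
    · exact hf
    · exact hg

/-- The intervals `[b, d]` with `1 ≤ b ≤ d ≤ 3`. -/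
inductive Interval
  | i11 | i12 | i13 | i22 | i23 | i33
  deriving DecidableEq

instance : Fintype Interval where
  elems := {.i11, .i12, .i13, .i22, .i23, .i33}
  complete I := by cases I <;> decide

/-- The interval representation power `𝕀[b,d]^m`: the direct sum of copies of `K` indexed by `m` at
the vertices `b, …, d`, the zero space elsewhere, and identity maps between the vertices `b, …, d`.
-/
noncomputable def intervalPower (K : Type u) [Field K] (I : Interval) (m : Type u) : A3Rep K :=
  let V : ModuleCat.{u} K := ModuleCat.of K (m →₀ K)
  let Z : ModuleCat.{u} K := ModuleCat.of K PUnit.{u + 1}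
  match I with
  | .i11 => span (0 : Z ⟶ V) (0 : Z ⟶ Z)
  | .i12 => span (𝟙 V) (0 : V ⟶ Z)
  | .i13 => span (𝟙 V) (𝟙 V)
  | .i22 => span (0 : V ⟶ Z) (0 : V ⟶ Z)
  | .i23 => span (0 : V ⟶ Z) (𝟙 V)
  | .i33 => span (0 : Z ⟶ Z) (0 : Z ⟶ V)

instance (K : Type u) [Field K] : HasFiniteBiproducts (A3Rep K) := Abelian.hasFiniteBiproducts

/-- An interval decomposition `V ≅ ⨁_{b ≤ d} 𝕀[b,d]^{m_{b,d}}`.  Each multiplicity is given by an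
index set, finite whenever the spaces of `V` are finite-dimensional. -/
structure IntervalDecomposition {K : Type u} [Field K] (V : A3Rep K) where
  /-- the index sets of the copies of each interval representation -/
  mult : Interval → Type u
  /-- the isomorphism onto the direct sum of interval representations -/
  iso : V ≅ ⨁ fun I => intervalPower K I (mult I)

/-- The block at `([1,3], [1,3])` of a morphism, with respect to interval decompositions of its
source and target. -/
noncomputable def block13 {K : Type u} [Field K] {V W : A3Rep K} (D : IntervalDecomposition V)
    (E : IntervalDecomposition W) (φ : V ⟶ W) :
    intervalPower K .i13 (D.mult .i13) ⟶ intervalPower K .i13 (E.mult .i13) :=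
  biproduct.ι (fun I => intervalPower K I (D.mult I)) .i13 ≫ D.iso.inv ≫ φ ≫ E.iso.hom ≫
    biproduct.π (fun I => intervalPower K I (E.mult I)) .i13

theorem block13_id {K : Type u} [Field K] {V : A3Rep K} (D : IntervalDecomposition V) :
    block13 D D (𝟙 V) = 𝟙 _ := by
  simp [block13]

/-- A morphism from another interval to `[1,3]` vanishes at the middle vertex. -/
theorem app_zero_eq_zero {K : Type u} [Field K] {I : Interval} (hI : I ≠ .i13) {m m' : Type u}
    (φ : intervalPower K I m ⟶ intervalPower K .i13 m') : φ.app WalkingSpan.zero = 0 := by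
  have h1 := φ.naturality WalkingSpan.Hom.fst
  have h2 := φ.naturality WalkingSpan.Hom.snd
  have e1 : (intervalPower K .i13 m').map WalkingSpan.Hom.fst = 𝟙 _ := rfl
  have e2 : (intervalPower K .i13 m').map WalkingSpan.Hom.snd = 𝟙 _ := rfl
  rw [e1] at h1
  rw [e2] at h2
  have k1 := h1.trans (Category.comp_id _)
  have k2 := h2.trans (Category.comp_id _)
  cases I with
  | i13 => exact absurd rfl hI
  | i11 => rw [← k2]; exact zero_comp
  | i12 => rw [← k2]; exact zero_comp
  | i22 => rw [← k2]; exact zero_comp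
  | i23 => rw [← k1]; exact zero_comp
  | i33 => rw [← k1]; exact zero_comp

/-- A morphism between powers of `𝕀[1,3]` is determined by its component at the middle vertex. -/
theorem hom13_ext {K : Type u} [Field K] {m m' : Type u}
    {φ ψ : intervalPower K .i13 m ⟶ intervalPower K .i13 m'}
    (h : φ.app WalkingSpan.zero = ψ.app WalkingSpan.zero) : φ = ψ := by
  have key : ∀ (j : WalkingSpan) (f : WalkingSpan.zero ⟶ j)
      (_ : IsIso ((intervalPower K .i13 m).map f)), φ.app j = ψ.app j := by
    intro j f hf
    rw [← cancel_epi ((intervalPower K .i13 m).map f), φ.naturality, ψ.naturality, h]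
  ext1
  funext j
  match j with
  | WalkingSpan.zero => exact h
  | WalkingSpan.left =>
    exact key _ WalkingSpan.Hom.fst (inferInstanceAs (IsIso (𝟙 (ModuleCat.of K (m →₀ K)))))
  | WalkingSpan.right =>
    exact key _ WalkingSpan.Hom.snd (inferInstanceAs (IsIso (𝟙 (ModuleCat.of K (m →₀ K)))))

/-- Restriction to the block `([1,3], [1,3])` is compatible with composition. -/
theorem block13_comp {K : Type u} [Field K] {U V W : A3Rep K} (D : IntervalDecomposition U)
    (E : IntervalDecomposition V) (F : IntervalDecomposition W) (φ : U ⟶ V) (ψ : V ⟶ W) :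
    block13 D F (φ ≫ ψ) = block13 D E φ ≫ block13 E F ψ := by
  have tot : φ ≫ ψ = ∑ I, φ ≫ E.iso.hom ≫
      (biproduct.π (fun I => intervalPower K I (E.mult I)) I ≫
        biproduct.ι (fun I => intervalPower K I (E.mult I)) I) ≫ E.iso.inv ≫ ψ := by
    rw [← Preadditive.comp_sum, ← Preadditive.comp_sum, ← Preadditive.sum_comp, biproduct.total]
    simp
  apply hom13_ext
  simp only [block13]
  rw [tot]
  simp only [Preadditive.sum_comp, Preadditive.comp_sum, NatTrans.app_sum]
  rw [Finset.sum_eq_single Interval.i13]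
  · simp only [Category.assoc]
  · intro I _ hI
    have h0 := app_zero_eq_zero hI (biproduct.ι (fun I => intervalPower K I (E.mult I)) I ≫
      E.iso.inv ≫ ψ ≫ F.iso.hom ≫ biproduct.π (fun I => intervalPower K I (F.mult I)) .i13)
    simp only [NatTrans.comp_app, Category.assoc] at h0 ⊢
    rw [h0]
    simp
  · simp

/-! ### Existence of interval decompositions -/

theorem exists_idempotents {K : Type u} [Field K] {V₁ V₂ V₃ : Type u} [AddCommGroup V₁]
    [AddCommGroup V₂] [AddCommGroup V₃] [Module K V₁] [Module K V₂] [Module K V₃]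
    (p : V₂ →ₗ[K] V₁) (q : V₂ →ₗ[K] V₃) :
    ∃ (g : V₁ →ₗ[K] V₂) (g' : V₃ →ₗ[K] V₂), (∀ v, p (g (p v)) = p v) ∧ (∀ v, q (g' (q v)) = q v) ∧
      (∀ v, g (p (g v)) = g v) ∧ (∀ v, g' (q (g' v)) = g' v) ∧
      (∀ v, g (p (g' (q v))) = g' (q (g (p v)))) := by
  have ginv : ∀ {A B : Type u} [AddCommGroup A] [AddCommGroup B] [Module K A] [Module K B]
      (f : A →ₗ[K] B), ∃ t : B →ₗ[K] A, ∀ v, f (t (f v)) = f v := by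
    intro A B _ _ _ _ f
    obtain ⟨s, hs⟩ := f.rangeRestrict.exists_rightInverse_of_surjective f.range_rangeRestrict
    obtain ⟨t, ht⟩ := LinearMap.exists_extend s
    refine ⟨t, fun v => ?_⟩
    have h1 : t (f v) = s (f.rangeRestrict v) := by
      rw [← ht]; rfl
    have h2 := LinearMap.congr_fun hs (f.rangeRestrict v)
    rw [h1]
    exact congrArg Subtype.val h2
  obtain ⟨t, ht⟩ := ginv p
  obtain ⟨s₀, hs₀⟩ := ginv q
  obtain ⟨s₁, hs₁⟩ := ginv (q ∘ₗ (LinearMap.ker p).subtype)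
  have hs₁' : ∀ v, p v = 0 → q (s₁ (q v)) = q v := fun v hv => hs₁ ⟨v, hv⟩
  have ps₁ : ∀ z, p (s₁ z) = 0 := fun z => (s₁ z).2
  -- a generalized inverse of `q` whose composition with `q` preserves the kernel of `p`
  let s : V₃ →ₗ[K] V₂ := (LinearMap.ker p).subtype ∘ₗ s₁ +
    s₀ ∘ₗ (LinearMap.id - q ∘ₗ (LinearMap.ker p).subtype ∘ₗ s₁)
  have sdef : ∀ z, s z = (s₁ z : V₂) + s₀ (z - q (s₁ z)) := fun z => rfl
  have qs : ∀ v, q (s (q v)) = q v := by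
    intro v
    have := hs₀ (v - (s₁ (q v) : V₂))
    rw [map_sub] at this
    rw [sdef, map_add, this]
    abel
  have psq : ∀ v, p v = 0 → p (s (q v)) = 0 := by
    intro v hv
    rw [sdef, hs₁' v hv, sub_self, map_zero, add_zero, ps₁]
  let y : V₂ →ₗ[K] V₂ := s ∘ₗ q
  have yy : ∀ v, y (y v) = y v := fun v => congrArg s (qs v)
  have qy : ∀ v, q (y v) = q v := qs
  have py : ∀ v, p v = 0 → p (y v) = 0 := psq
  let x : V₂ →ₗ[K] V₂ := y ∘ₗ t ∘ₗ p ∘ₗ y +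
    (LinearMap.id - y) ∘ₗ t ∘ₗ p ∘ₗ (LinearMap.id - y)
  have xdef : ∀ v, x v = y (t (p (y v))) + (t (p (v - y v)) - y (t (p (v - y v)))) := fun v => rfl
  have xker : ∀ v, p v = 0 → x v = 0 := by
    intro v hv
    rw [xdef, py v hv, map_sub, hv, py v hv]
    simp
  have pytp : ∀ v, p (y (t (p v))) = p (y v) := by
    intro v
    have := py (t (p v) - v) (by rw [map_sub, ht, sub_self])
    rw [map_sub, map_sub] at this
    exact sub_eq_zero.mp this
  have px : ∀ v, p (x v) = p v := by
    intro v
    rw [xdef, map_add, map_sub, pytp, pytp, ht, map_sub, map_sub, yy]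
    simp
  have xy : ∀ v, x (y v) = y (x v) := by
    intro v
    simp only [xdef, map_add, map_sub, yy, sub_self, map_zero, add_zero]
  have xtp : ∀ v, x (t (p v)) = x v := by
    intro v
    have := xker (t (p v) - v) (by rw [map_sub, ht, sub_self])
    rw [map_sub] at this
    exact sub_eq_zero.mp this
  have xx : ∀ v, x (x v) = x v := by
    intro v
    have := xker (x v - v) (by rw [map_sub, px, sub_self])
    rw [map_sub] at this
    exact sub_eq_zero.mp this
  refine ⟨x ∘ₗ t, s ∘ₗ q ∘ₗ s, ?_, ?_, ?_, ?_, ?_⟩ <;> intro v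
  · change p (x (t (p v))) = p v
    rw [xtp, px]
  · change q (s (q (s (q v)))) = q v
    rw [qs, qs]
  · change x (t (p (x (t v)))) = x (t v)
    rw [xtp, xx]
  · change s (q (s (q (s (q (s v)))))) = s (q (s v))
    rw [qs, qs]
  · change x (t (p (s (q (s (q v)))))) = s (q (s (q (x (t (p v))))))
    rw [qs, qs, xtp, xtp]
    exact xy v

/-- An idempotent of a vector space splits through a coordinate space. -/
theorem exists_split {K : Type u} [Field K] {V : Type u} [AddCommGroup V] [Module K V]
    (e : V →ₗ[K] V) (he : ∀ v, e (e v) = e v) :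
    ∃ (m : Type u) (a : (m →₀ K) →ₗ[K] V) (b : V →ₗ[K] (m →₀ K)),
      (∀ v, a (b v) = e v) ∧ ∀ w, b (a w) = w := by
  let B := Module.Basis.ofVectorSpace K (LinearMap.range e)
  refine ⟨_, (LinearMap.range e).subtype ∘ₗ B.repr.symm.toLinearMap,
    B.repr.toLinearMap ∘ₗ e.rangeRestrict, fun v => ?_, fun w => ?_⟩
  · simp
  · have h : e.rangeRestrict (B.repr.symm w) = B.repr.symm w := by
      obtain ⟨v, hv⟩ := (B.repr.symm w).2
      apply Subtype.ext
      change e (B.repr.symm w : V) = _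
      rw [← hv, he]
    change B.repr (e.rangeRestrict (B.repr.symm w : V)) = w
    rw [h]
    simp

theorem span_hom_ext {C : Type*} [Category C] {F G : WalkingSpan ⥤ C} {φ ψ : F ⟶ G}
    (h₁ : φ.app WalkingSpan.left = ψ.app WalkingSpan.left)
    (h₂ : φ.app WalkingSpan.zero = ψ.app WalkingSpan.zero)
    (h₃ : φ.app WalkingSpan.right = ψ.app WalkingSpan.right) : φ = ψ := by
  ext1
  funext j
  match j with
  | WalkingSpan.left => exact h₁
  | WalkingSpan.zero => exact h₂
  | WalkingSpan.right => exact h₃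

/-- A decomposition assembled from inclusions and projections. -/
noncomputable def IntervalDecomposition.ofTotal {K : Type u} [Field K] {V : A3Rep K}
    (m : Interval → Type u) (i : ∀ I, intervalPower K I (m I) ⟶ V)
    (r : ∀ I, V ⟶ intervalPower K I (m I)) (h : ∀ I, i I ≫ r I = 𝟙 _)
    (h' : ∀ I J, I ≠ J → i I ≫ r J = 0) (tot : ∑ I, r I ≫ i I = 𝟙 V) :
    IntervalDecomposition V where
  mult := m
  iso :=
    { hom := biproduct.lift r
      inv := biproduct.desc i
      hom_inv_id := by rw [biproduct.lift_desc, tot]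
      inv_hom_id := by
        apply biproduct.hom_ext'
        intro I
        apply biproduct.hom_ext
        intro J
        by_cases hIJ : I = J
        · subst hIJ
          simp [h]
        · simp [h' I J hIJ, biproduct.ι_π_ne _ hIJ] }

/-- Every representation of `1 ← 2 → 3` has an interval decomposition. -/
theorem exists_intervalDecomposition {K : Type u} [Field K] (V : A3Rep K) :
    Nonempty (IntervalDecomposition V) := by
  suffices H : ∀ {V₁ V₂ V₃ : ModuleCat.{u} K} (f : V₂ ⟶ V₁) (f' : V₂ ⟶ V₃),
      Nonempty (IntervalDecomposition (span f f')) by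
    obtain ⟨D⟩ := H (V.map WalkingSpan.Hom.fst) (V.map WalkingSpan.Hom.snd)
    exact ⟨⟨D.mult, diagramIsoSpan V ≪≫ D.iso⟩⟩
  intro V₁ V₂ V₃ f f'
  obtain ⟨g₀, g₀', hp₀, hq₀, hg₀, hg'₀, hc₀⟩ := exists_idempotents f.hom f'.hom
  obtain ⟨m₁₁, a₁₁, b₁₁, hab₁₁, hba₁₁⟩ := exists_split (LinearMap.id - f.hom ∘ₗ g₀) (by
    intro v; simp [hp₀])
  obtain ⟨m₃₃, a₃₃, b₃₃, hab₃₃, hba₃₃⟩ := exists_split (LinearMap.id - f'.hom ∘ₗ g₀') (by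
    intro v; simp [hq₀])
  obtain ⟨m₁₃, a₁₃, b₁₃, hab₁₃, hba₁₃⟩ := exists_split (g₀ ∘ₗ f.hom ∘ₗ g₀' ∘ₗ f'.hom) (by
    intro v; simp [hg₀, hc₀, hq₀])
  obtain ⟨m₁₂, a₁₂, b₁₂, hab₁₂, hba₁₂⟩ := exists_split
    (g₀ ∘ₗ f.hom - g₀ ∘ₗ f.hom ∘ₗ g₀' ∘ₗ f'.hom) (by
    intro v; simp [hg₀, hc₀, hq₀])
  obtain ⟨m₂₃, a₂₃, b₂₃, hab₂₃, hba₂₃⟩ := exists_split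
    (g₀' ∘ₗ f'.hom - g₀ ∘ₗ f.hom ∘ₗ g₀' ∘ₗ f'.hom) (by
    intro v; simp [hc₀, hq₀, hp₀])
  obtain ⟨m₂₂, a₂₂, b₂₂, hab₂₂, hba₂₂⟩ := exists_split
    (LinearMap.id - g₀ ∘ₗ f.hom - g₀' ∘ₗ f'.hom + g₀ ∘ₗ f.hom ∘ₗ g₀' ∘ₗ f'.hom) (by
    intro v; simp [hc₀, hq₀, hp₀])
  -- the images of the inclusions and the projections under the idempotents
  have ea : ∀ {A : ModuleCat.{u} K} {m : Type u} {e : A →ₗ[K] A} {a : (m →₀ K) →ₗ[K] A}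
      {b : A →ₗ[K] (m →₀ K)}, (∀ v, a (b v) = e v) → (∀ w, b (a w) = w) → ∀ w, a w = e (a w) := by
    intro A m e a b h h' w
    rw [← h, h']
  have eb : ∀ {A : ModuleCat.{u} K} {m : Type u} {e : A →ₗ[K] A} {a : (m →₀ K) →ₗ[K] A}
      {b : A →ₗ[K] (m →₀ K)}, (∀ v, a (b v) = e v) → (∀ w, b (a w) = w) → ∀ v, b v = b (e v) := by
    intro A m e a b h h' w
    rw [← h, h']
  have gg : ∀ v, g₀ (f.hom (g₀' (f'.hom (g₀ (f.hom v))))) = g₀ (f.hom (g₀' (f'.hom v))) := by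
    intro v; rw [← hc₀, hp₀]
  have gg' : ∀ v, g₀' (f'.hom (g₀ (f.hom v))) = g₀ (f.hom (g₀' (f'.hom v))) :=
    fun v => (hc₀ v).symm
  have pa₁₃ : ∀ w, g₀ (f.hom (a₁₃ w)) = a₁₃ w := by
    intro w; rw [ea hab₁₃ hba₁₃ w]; simp [hp₀]
  have qa₁₃ : ∀ w, g₀' (f'.hom (a₁₃ w)) = a₁₃ w := by
    intro w; rw [ea hab₁₃ hba₁₃ w]; simp [hq₀, gg']
  have pa₁₂ : ∀ w, g₀ (f.hom (a₁₂ w)) = a₁₂ w := by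
    intro w; rw [ea hab₁₂ hba₁₂ w]; simp [hp₀]
  have qa₁₂ : ∀ w, f'.hom (a₁₂ w) = 0 := by
    intro w; rw [← hq₀, ea hab₁₂ hba₁₂ w]; simp [hq₀, gg']
  have pa₂₃ : ∀ w, f.hom (a₂₃ w) = 0 := by
    intro w; rw [ea hab₂₃ hba₂₃ w]; simp [hp₀]
  have qa₂₃ : ∀ w, g₀' (f'.hom (a₂₃ w)) = a₂₃ w := by
    intro w; rw [ea hab₂₃ hba₂₃ w]; simp [hq₀, gg']
  have pa₂₂ : ∀ w, f.hom (a₂₂ w) = 0 := by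
    intro w; rw [ea hab₂₂ hba₂₂ w]; simp [hp₀]
  have qa₂₂ : ∀ w, f'.hom (a₂₂ w) = 0 := by
    intro w; rw [← hq₀, ea hab₂₂ hba₂₂ w]; simp [hq₀, gg']
  have ga₁₁ : ∀ w, g₀ (a₁₁ w) = 0 := by
    intro w; rw [ea hab₁₁ hba₁₁ w]; simp [hg₀]
  have ga₃₃ : ∀ w, g₀' (a₃₃ w) = 0 := by
    intro w; rw [ea hab₃₃ hba₃₃ w]; simp [hg'₀]
  have bp₁₃ : ∀ v, b₁₃ (g₀ (f.hom v)) = b₁₃ v := by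
    intro v; rw [eb hab₁₃ hba₁₃, eb hab₁₃ hba₁₃ v]; simp [gg]
  have bq₁₃ : ∀ v, b₁₃ (g₀' (f'.hom v)) = b₁₃ v := by
    intro v; rw [eb hab₁₃ hba₁₃, eb hab₁₃ hba₁₃ v]; simp [hq₀]
  have bp₁₂ : ∀ v, b₁₂ (g₀ (f.hom v)) = b₁₂ v := by
    intro v; rw [eb hab₁₂ hba₁₂, eb hab₁₂ hba₁₂ v]; simp [gg, hp₀]
  have bq₁₂ : ∀ v, b₁₂ (g₀' (f'.hom v)) = 0 := by
    intro v; rw [eb hab₁₂ hba₁₂]; simp [hq₀]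
  have bp₂₃ : ∀ v, b₂₃ (g₀ (f.hom v)) = 0 := by
    intro v; rw [eb hab₂₃ hba₂₃]; simp [gg', hp₀]
  have bq₂₃ : ∀ v, b₂₃ (g₀' (f'.hom v)) = b₂₃ v := by
    intro v; rw [eb hab₂₃ hba₂₃, eb hab₂₃ hba₂₃ v]; simp [hq₀]
  have bp₂₂ : ∀ v, b₂₂ (g₀ (f.hom v)) = 0 := by
    intro v; rw [eb hab₂₂ hba₂₂]; simp [gg', hp₀]
  have bq₂₂ : ∀ v, b₂₂ (g₀' (f'.hom v)) = 0 := by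
    intro v; rw [eb hab₂₂ hba₂₂]; simp [hq₀]
  have bp₁₁ : ∀ v, b₁₁ (f.hom v) = 0 := by
    intro v; rw [eb hab₁₁ hba₁₁]; simp [hp₀]
  have bq₃₃ : ∀ v, b₃₃ (f'.hom v) = 0 := by
    intro v; rw [eb hab₃₃ hba₃₃]; simp [hq₀]
  have c₁ : ∀ w, b₁₂ (a₁₃ w) = 0 := fun w => by rw [← qa₁₃, bq₁₂]
  have c₂ : ∀ w, b₂₃ (a₁₃ w) = 0 := fun w => by rw [← pa₁₃, bp₂₃]
  have c₃ : ∀ w, b₂₂ (a₁₃ w) = 0 := fun w => by rw [← pa₁₃, bp₂₂]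
  have c₄ : ∀ w, b₁₃ (a₁₂ w) = 0 := fun w => by rw [← bq₁₃, qa₁₂, map_zero, map_zero]
  have c₅ : ∀ w, b₂₃ (a₁₂ w) = 0 := fun w => by rw [← pa₁₂, bp₂₃]
  have c₆ : ∀ w, b₂₂ (a₁₂ w) = 0 := fun w => by rw [← pa₁₂, bp₂₂]
  have c₇ : ∀ w, b₁₃ (a₂₃ w) = 0 := fun w => by rw [← bp₁₃, pa₂₃, map_zero, map_zero]
  have c₈ : ∀ w, b₁₂ (a₂₃ w) = 0 := fun w => by rw [← qa₂₃, bq₁₂]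
  have c₉ : ∀ w, b₂₂ (a₂₃ w) = 0 := fun w => by rw [← qa₂₃, bq₂₂]
  have d₁ : ∀ w, b₁₃ (a₂₂ w) = 0 := fun w => by rw [← bp₁₃, pa₂₂, map_zero, map_zero]
  have d₂ : ∀ w, b₁₂ (a₂₂ w) = 0 := fun w => by rw [← bp₁₂, pa₂₂, map_zero, map_zero]
  have d₃ : ∀ w, b₂₃ (a₂₂ w) = 0 := fun w => by rw [← bq₂₃, qa₂₂, map_zero, map_zero]
  let m : Interval → Type u
    | .i11 => m₁₁
    | .i12 => m₁₂
    | .i13 => m₁₃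
    | .i22 => m₂₂
    | .i23 => m₂₃
    | .i33 => m₃₃
  let i : ∀ I, intervalPower K I (m I) ⟶ span f f'
    | .i11 => spanMap (ModuleCat.ofHom a₁₁) 0 0 (by simp) (by simp)
    | .i12 => spanMap (ModuleCat.ofHom (f.hom ∘ₗ a₁₂)) (ModuleCat.ofHom a₁₂) 0
        (by ext : 2; simp) (ModuleCat.hom_ext (LinearMap.ext fun w => (qa₁₂ w).symm))
    | .i13 => spanMap (ModuleCat.ofHom (f.hom ∘ₗ a₁₃)) (ModuleCat.ofHom a₁₃)
        (ModuleCat.ofHom (f'.hom ∘ₗ a₁₃)) (by ext : 2; simp) (by ext : 2; simp)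
    | .i22 => spanMap 0 (ModuleCat.ofHom a₂₂) 0
        (ModuleCat.hom_ext (LinearMap.ext fun w => (pa₂₂ w).symm)) (ModuleCat.hom_ext (LinearMap.ext fun w => (qa₂₂ w).symm))
    | .i23 => spanMap 0 (ModuleCat.ofHom a₂₃) (ModuleCat.ofHom (f'.hom ∘ₗ a₂₃))
        (ModuleCat.hom_ext (LinearMap.ext fun w => (pa₂₃ w).symm)) (by ext : 2; simp)
    | .i33 => spanMap 0 0 (ModuleCat.ofHom a₃₃) (by simp) (by simp)
  let r : ∀ I, span f f' ⟶ intervalPower K I (m I)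
    | .i11 => spanMap (ModuleCat.ofHom b₁₁) 0 0 (by ext : 2; simp [bp₁₁]) (by simp)
    | .i12 => spanMap (ModuleCat.ofHom (b₁₂ ∘ₗ g₀)) (ModuleCat.ofHom b₁₂) 0
        (by ext : 2; simp [bp₁₂]) (by simp)
    | .i13 => spanMap (ModuleCat.ofHom (b₁₃ ∘ₗ g₀)) (ModuleCat.ofHom b₁₃)
        (ModuleCat.ofHom (b₁₃ ∘ₗ g₀')) (by ext : 2; simp [bp₁₃]) (by ext : 2; simp [bq₁₃])
    | .i22 => spanMap 0 (ModuleCat.ofHom b₂₂) 0 (by simp) (by simp)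
    | .i23 => spanMap 0 (ModuleCat.ofHom b₂₃) (ModuleCat.ofHom (b₂₃ ∘ₗ g₀'))
        (by simp) (by ext : 2; simp [bq₂₃])
    | .i33 => spanMap 0 0 (ModuleCat.ofHom b₃₃) (by simp) (by ext : 2; simp [bq₃₃])
  have l1 : ∀ w, b₁₂ (g₀ (f.hom (a₁₃ w))) = 0 := fun w => by
    rw [pa₁₃, c₁]
  have l2 : ∀ w, b₁₃ (g₀ (f.hom (a₁₂ w))) = 0 := fun w => by
    rw [pa₁₂, c₄]
  have l3 : ∀ w, b₁₂ (g₀ (f.hom (a₁₂ w))) = w := fun w => by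
    rw [pa₁₂, hba₁₂]
  have l4 : ∀ w, b₁₃ (g₀ (f.hom (a₁₃ w))) = w := fun w => by
    rw [pa₁₃, hba₁₃]
  have l5 : ∀ w, b₂₃ (g₀' (f'.hom (a₁₃ w))) = 0 := fun w => by
    rw [qa₁₃, c₂]
  have l6 : ∀ w, b₁₃ (g₀' (f'.hom (a₂₃ w))) = 0 := fun w => by
    rw [qa₂₃, c₇]
  have l7 : ∀ w, b₂₃ (g₀' (f'.hom (a₂₃ w))) = w := fun w => by
    rw [qa₂₃, hba₂₃]
  have l8 : ∀ w, b₁₃ (g₀' (f'.hom (a₁₃ w))) = w := fun w => by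
    rw [qa₁₃, hba₁₃]
  have l9 : ∀ w, b₁₂ (g₀ (a₁₁ w)) = 0 := fun w => by
    rw [ga₁₁, map_zero]
  have l10 : ∀ w, b₁₃ (g₀ (a₁₁ w)) = 0 := fun w => by
    rw [ga₁₁, map_zero]
  have l11 : ∀ w, b₂₃ (g₀' (a₃₃ w)) = 0 := fun w => by
    rw [ga₃₃, map_zero]
  have l12 : ∀ w, b₁₃ (g₀' (a₃₃ w)) = 0 := fun w => by
    rw [ga₃₃, map_zero]
  have t₁ : ∀ v : V₁, a₁₁ (b₁₁ v) + (f.hom (a₁₂ (b₁₂ (g₀ v))) + (f.hom (a₁₃ (b₁₃ (g₀ v))) +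
      (0 + (0 + 0)))) = v := by
    intro v
    rw [hab₁₁, hab₁₂, hab₁₃]
    simp [hg₀]
  have t₂ : ∀ v : V₂, 0 + (a₁₂ (b₁₂ v) + (a₁₃ (b₁₃ v) + (a₂₂ (b₂₂ v) + (a₂₃ (b₂₃ v) + 0)))) =
      v := by
    intro v
    rw [hab₁₂, hab₁₃, hab₂₂, hab₂₃]
    simp only [LinearMap.add_apply, LinearMap.sub_apply, LinearMap.comp_apply, LinearMap.id_apply]
    abel
  have t₃ : ∀ v : V₃, 0 + (0 + (f'.hom (a₁₃ (b₁₃ (g₀' v))) + (0 +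
      (f'.hom (a₂₃ (b₂₃ (g₀' v))) + a₃₃ (b₃₃ v))))) = v := by
    intro v
    rw [hab₁₃, hab₂₃, hab₃₃]
    simp [hg'₀]
  refine ⟨IntervalDecomposition.ofTotal m i r ?_ ?_ ?_⟩
  · intro I
    cases I <;> refine span_hom_ext ?_ ?_ ?_ <;>
      refine ModuleCat.hom_ext (LinearMap.ext fun w => ?_) <;>
      first | rfl |
        exact hba₁₁ w | exact hba₁₂ w | exact hba₁₃ w | exact hba₂₂ w | exact hba₂₃ w |
        exact hba₃₃ w | exact l3 w | exact l4 w | exact l7 w | exact l8 w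
  · intro I J hIJ
    cases I <;> cases J <;> first | exact absurd rfl hIJ |
      (refine span_hom_ext ?_ ?_ ?_ <;>
      refine ModuleCat.hom_ext (LinearMap.ext fun w => ?_) <;>
      first | rfl | exact map_zero _ | exact bp₁₁ _ | exact bq₃₃ _ |
        exact c₁ w | exact c₂ w | exact c₃ w | exact c₄ w | exact c₅ w | exact c₆ w |
        exact c₇ w | exact c₈ w | exact c₉ w | exact d₁ w | exact d₂ w | exact d₃ w |
        exact l1 w | exact l2 w | exact l5 w | exact l6 w | exact l9 w | exact l10 w |
        exact l11 w | exact l12 w)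
  · have huniv : (Finset.univ : Finset Interval) = {.i11, .i12, .i13, .i22, .i23, .i33} := rfl
    rw [huniv]
    simp only [Finset.sum_insert, Finset.sum_singleton, Finset.mem_insert, Finset.mem_singleton,
      reduceCtorEq, or_self, not_false_eq_true]
    refine span_hom_ext ?_ ?_ ?_ <;> refine ModuleCat.hom_ext (LinearMap.ext fun v => ?_)
    · exact t₁ v
    · exact t₂ v
    · exact t₃ v

/-! ### `ℝ`-persistence modules and the interleaving distance -/

/-- Given an `ℝ`-indexed family of representations of `1 ← 2 → 3` and an interval decomposition of
each of them, the `ℝ`-persistence module `r ↦ K^{m_{1,3}^r}` of the `[1,3]`-parts, whose transition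
maps are the `([1,3], [1,3])`-blocks of the transition maps of the family (`𝕀[1,3]^m` is identified
with `K^m` through its middle vertex). -/
noncomputable def blockModule {K : Type u} [Field K] (P : ℝ ⥤ A3Rep K)
    (D : ∀ r, IntervalDecomposition (P.obj r)) : ℝ ⥤ ModuleCat.{u} K where
  obj r := ModuleCat.of K ((D r).mult .i13 →₀ K)
  map {r s} φ := (block13 (D r) (D s) (P.map φ)).app WalkingSpan.zero
  map_id r := by
    rw [P.map_id, block13_id]
    rfl
  map_comp φ ψ := by
    rw [P.map_comp, block13_comp _ (D _)]
    rfl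

/-- The functor `t ↦ t + δ`. -/
abbrev translation (δ : ℝ) : ℝ ⥤ ℝ where
  obj t := t + δ
  map f := homOfLE (add_le_add_left (leOfHom f) δ)

/-- The shift functor `M ↦ M(δ)`, with `M(δ)_t = M_{t+δ}`. -/
abbrev shift {K : Type u} [Field K] (δ : ℝ) : (ℝ ⥤ ModuleCat.{u} K) ⥤ (ℝ ⥤ ModuleCat.{u} K) :=
  (Functor.whiskeringLeft ℝ ℝ (ModuleCat.{u} K)).obj (translation δ)

/-- The transition morphism `M ⟶ M(δ)(δ) = M(2δ)`. -/
def transition {K : Type u} [Field K] (M : ℝ ⥤ ModuleCat.{u} K) (δ : ℝ≥0) :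
    M ⟶ (shift (δ : ℝ)).obj ((shift (δ : ℝ)).obj M) where
  app t := M.map (homOfLE (show t ≤ t + (δ : ℝ) + (δ : ℝ) by linarith [δ.coe_nonneg]))
  naturality s t f := by
    change M.map _ ≫ M.map _ = M.map _ ≫ M.map _
    rw [← M.map_comp, ← M.map_comp]
    rfl

/-- `M` and `N` are `δ`-interleaved. -/
def Interleaved {K : Type u} [Field K] (M N : ℝ ⥤ ModuleCat.{u} K) (δ : ℝ≥0) : Prop :=
  ∃ (f : M ⟶ (shift (δ : ℝ)).obj N) (g : N ⟶ (shift (δ : ℝ)).obj M),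
    f ≫ (shift (δ : ℝ)).map g = transition M δ ∧ g ≫ (shift (δ : ℝ)).map f = transition N δ

/-- The interleaving distance; the infimum of the empty set is `∞`. -/
noncomputable def interleavingDist {K : Type u} [Field K] (M N : ℝ ⥤ ModuleCat.{u} K) : ℝ≥0∞ :=
  ⨅ (δ : ℝ≥0) (_ : Interleaved M N δ), (δ : ℝ≥0∞)

/-! ### The filtration of a sampled map -/

/-- The sublevel set `U_r = d_U⁻¹[0, r]` of the distance to `U`; it is empty for `r < 0`. -/
def sublevel {E : Type} [PseudoEMetricSpace E] (U : Set E) (r : ℝ) : Set E :=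
  {x | 0 ≤ r ∧ Metric.infEDist x U ≤ ENNReal.ofReal r}

theorem sublevel_mono {E : Type} [PseudoEMetricSpace E] (U : Set E) {r s : ℝ} (h : r ≤ s) :
    sublevel U r ⊆ sublevel U s :=
  fun _ hx => ⟨hx.1.trans h, hx.2.trans (ENNReal.ofReal_le_ofReal h)⟩

/-- A map that is `1`-Lipschitz and sends `U` into `V` sends `U_r` into `V_r`. -/
theorem mapsTo_sublevel {E F : Type} [PseudoEMetricSpace E] [PseudoEMetricSpace F] {U : Set E}
    {V : Set F} {p : E → F} (hp : LipschitzWith 1 p) (hU : Set.MapsTo p U V) (r : ℝ) :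
    Set.MapsTo p (sublevel U r) (sublevel V r) := by
  rintro x ⟨h0, hx⟩
  refine ⟨h0, le_trans ?_ hx⟩
  refine Metric.le_infEDist.mpr fun y hy => ?_
  refine (Metric.infEDist_le_edist_of_mem (hU hy)).trans ?_
  simpa using hp x y

/-- `ℝⁿ` with the Euclidean metric.  The metric of a product `A × B` in Mathlib is the maximum of
the metrics of the factors. -/
abbrev Euc (n : ℕ) : Type := EuclideanSpace ℝ (Fin n)

/-- The graph `Gr(h) = {(s, h(s)) | s ∈ S}` of a map `h : S → ℝⁿ`. -/
def graph {n : ℕ} {S : Finset (Euc n)} (h : S → Euc n) : Set (Euc n × Euc n) :=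
  Set.range fun s : S => ((s : Euc n), h s)

theorem fst_mapsTo {n : ℕ} {S : Finset (Euc n)} (h : S → Euc n) (r : ℝ) :
    Set.MapsTo Prod.fst (sublevel (graph h) r) (sublevel (S : Set (Euc n)) r) :=
  mapsTo_sublevel LipschitzWith.prod_fst (by rintro _ ⟨s, rfl⟩; exact s.2) r

theorem snd_mapsTo {n : ℕ} {S : Finset (Euc n)} (h : S → Euc n) (r : ℝ) :
    Set.MapsTo Prod.snd (sublevel (graph h) r) (sublevel (Set.range h) r) :=
  mapsTo_sublevel LipschitzWith.prod_snd (by rintro _ ⟨s, rfl⟩; exact ⟨s, rfl⟩) r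

/-- The inclusion of sublevel sets `U_r → U_s` for `r ≤ s`. -/
def sublevelIncl {E : Type} [PseudoEMetricSpace E] (U : Set E) {r s : ℝ} (h : r ≤ s) :
    TopCat.of (sublevel U r) ⟶ TopCat.of (sublevel U s) :=
  TopCat.ofHom ⟨Set.inclusion (sublevel_mono U h), continuous_inclusion _⟩

/-- The diagram `S_r ← Gr(h)_r → h(S)_r`, whose maps are the restrictions of the two projections. -/
noncomputable def topDiagram {n : ℕ} {S : Finset (Euc n)} (h : S → Euc n) (r : ℝ) : WalkingSpan ⥤ TopCat.{0} :=
  span (X := TopCat.of (sublevel (graph h) r)) (Y := TopCat.of (sublevel (S : Set (Euc n)) r))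
    (Z := TopCat.of (sublevel (Set.range h) r))
    (TopCat.ofHom ⟨(fst_mapsTo h r).restrict, continuous_fst.restrict (fst_mapsTo h r)⟩)
    (TopCat.ofHom ⟨(snd_mapsTo h r).restrict, continuous_snd.restrict (snd_mapsTo h r)⟩)

/-- The filtration `r ↦ (S_r ← Gr(h)_r → h(S)_r)`, with the inclusions as transition maps. -/
noncomputable def filtration {n : ℕ} {S : Finset (Euc n)} (h : S → Euc n) : ℝ ⥤ WalkingSpan ⥤ TopCat.{0} where
  obj := topDiagram h
  map f := spanMap (sublevelIncl _ (leOfHom f)) (sublevelIncl _ (leOfHom f))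
    (sublevelIncl _ (leOfHom f)) rfl rfl
  map_id _ := span_hom_ext rfl rfl rfl
  map_comp _ _ := span_hom_ext rfl rfl rfl

/-! ### Homology and the persistence module of a sampled map -/

/-- Singular homology in degree `k` with coefficients in `K`. -/
noncomputable def homology (K : Type u) [Field K] (k : ℕ) : TopCat.{0} ⥤ ModuleCat.{u} K :=
  (AlgebraicTopology.singularHomologyFunctor (ModuleCat.{u} K) k).obj (ModuleCat.of K K)

/-- Total singular homology, the direct sum over all degrees. -/
noncomputable def totalHomology (K : Type u) [Field K] : TopCat.{0} ⥤ ModuleCat.{u} K :=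
  ∐ fun k : ℕ => homology K k

/-- The family of representations `HS_r ← HGr(h)_r → Hh(S)_r`. -/
noncomputable def homologyFamily {K : Type u} [Field K] (H : TopCat.{0} ⥤ ModuleCat.{u} K) {n : ℕ}
    {S : Finset (Euc n)} (h : S → Euc n) : ℝ ⥤ A3Rep K :=
  filtration h ⋙ (Functor.whiskeringRight WalkingSpan TopCat.{0} (ModuleCat.{u} K)).obj H

/-- The `ℝ`-persistence module `M^h` of the sampled map `h`, computed with the homology functor `H`
and interval decompositions `D r` of the representations `HS_r ← HGr(h)_r → Hh(S)_r`. -/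
noncomputable def persistenceModule {K : Type u} [Field K] (H : TopCat.{0} ⥤ ModuleCat.{u} K)
    {n : ℕ} {S : Finset (Euc n)} (h : S → Euc n)
    (D : ∀ r, IntervalDecomposition ((homologyFamily H h).obj r)) : ℝ ⥤ ModuleCat.{u} K :=
  blockModule (homologyFamily H h) D

end SampledMap

/-! Let `δ` be the Hausdorff distance of the two graphs, assumed finite. The coordinate projections
are `1`-Lipschitz and carry the graphs onto the domains and the ranges, so these are also within `δ`
of each other. By the triangle inequality `U_r ⊆ V_{r+δ}` for each of the three pairs of sets. These
inclusions commute with the projections, and going there and back is the inclusion `U_r ⊆ U_{r+2δ}`;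
the two filtrations of diagrams are thus `δ`-interleaved. Any functor `H` preserves this, so nothing
about homology beyond functoriality is needed.

The remaining point is that passing to the `([1,3],[1,3])`-block preserves the interleaving,
although the decompositions at different levels are unrelated. A block of a composite could a priori
receive contributions through the other summands. But a morphism from an interval other than `[1,3]`
into `[1,3]` vanishes at the middle vertex, and morphisms between powers of `𝕀[1,3]` are determined
there, so every such detour is zero. Hence blocks compose (`block13_comp`) for arbitrary choices,
and `blockShift_comp` transfers the interleaving equations. -/

namespace SampledMap

/-! ### Hausdorff distances of graphs, domains and ranges -/

/-- Sublevel sets of two sets at Hausdorff distance at most `δ` are included in each other after a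
shift of the level by `δ`. -/
theorem sublevel_subset_sublevel_add {E : Type} [PseudoEMetricSpace E] {U V : Set E} {δ : ℝ≥0}
    (h : Metric.hausdorffEDist U V ≤ δ) (r : ℝ) : sublevel U r ⊆ sublevel V (r + δ) := by
  rintro x ⟨h0, hx⟩
  refine ⟨add_nonneg h0 δ.coe_nonneg, ?_⟩
  -- `ENNReal.ofReal` truncates negative numbers to `0`, so splitting the sum relies on the
  -- condition `0 ≤ r` built into `sublevel`.
  rw [ENNReal.ofReal_add h0 δ.coe_nonneg, ENNReal.ofReal_coe_nnreal]
  exact Metric.infEDist_le_infEDist_add_hausdorffEDist.trans (add_le_add hx h)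

/-- A `1`-Lipschitz map does not increase Hausdorff distances. -/
theorem hausdorffEDist_image_le_of_lipschitzWith_one {E F : Type} [PseudoEMetricSpace E]
    [PseudoEMetricSpace F] {p : E → F} (hp : LipschitzWith 1 p) (U V : Set E) :
    Metric.hausdorffEDist (p '' U) (p '' V) ≤ Metric.hausdorffEDist U V := by
  -- Each point `y` of `W` competing in the infimum on the right yields the competitor `p y` on the
  -- left, which is no farther away.
  have key : ∀ (W : Set E) (x : E), Metric.infEDist (p x) (p '' W) ≤ Metric.infEDist x W := by
    intro W x
    refine Metric.le_infEDist.mpr fun y hy => ?_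
    refine (Metric.infEDist_le_edist_of_mem (Set.mem_image_of_mem p hy)).trans ?_
    simpa using hp x y
  refine Metric.hausdorffEDist_le_of_infEDist ?_ ?_
  · rintro _ ⟨x, hx, rfl⟩
    exact (key V x).trans (Metric.infEDist_le_hausdorffEDist_of_mem hx)
  · rintro _ ⟨x, hx, rfl⟩
    rw [Metric.hausdorffEDist_comm]
    exact (key U x).trans (Metric.infEDist_le_hausdorffEDist_of_mem hx)

theorem image_fst_graph {n : ℕ} {S : Finset (Euc n)} (h : S → Euc n) :
    Prod.fst '' graph h = (S : Set (Euc n)) := by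
  ext x
  simp [graph]

theorem image_snd_graph {n : ℕ} {S : Finset (Euc n)} (h : S → Euc n) :
    Prod.snd '' graph h = Set.range h := by
  rw [graph, ← Set.range_comp]
  rfl

/-- The domain is the full image of the graph under the first projection, which is `1`-Lipschitz for
the maximum metric. -/
theorem hausdorffEDist_domain_le {n : ℕ} {S S' : Finset (Euc n)} (h : S → Euc n)
    (h' : S' → Euc n) :
    Metric.hausdorffEDist (S : Set (Euc n)) S' ≤ Metric.hausdorffEDist (graph h) (graph h') := by
  rw [← image_fst_graph h, ← image_fst_graph h']
  exact hausdorffEDist_image_le_of_lipschitzWith_one LipschitzWith.prod_fst _ _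

theorem hausdorffEDist_range_le {n : ℕ} {S S' : Finset (Euc n)} (h : S → Euc n)
    (h' : S' → Euc n) :
    Metric.hausdorffEDist (Set.range h) (Set.range h') ≤
      Metric.hausdorffEDist (graph h) (graph h') := by
  rw [← image_snd_graph h, ← image_snd_graph h']
  exact hausdorffEDist_image_le_of_lipschitzWith_one LipschitzWith.prod_snd _ _

/-! ### Interleaving of the filtrations of spaces -/

/-- The inclusion `U_r → V_{r+δ}` for sets at Hausdorff distance at most `δ`. -/
def sublevelShift {E : Type} [PseudoEMetricSpace E] {U V : Set E} {δ : ℝ≥0}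
    (h : Metric.hausdorffEDist U V ≤ δ) (r : ℝ) :
    TopCat.of (sublevel U r) ⟶ TopCat.of (sublevel V (r + δ)) :=
  TopCat.ofHom ⟨Set.inclusion (sublevel_subset_sublevel_add h r), continuous_inclusion _⟩

/-- The shifting inclusions between the filtrations of two sampled maps whose graphs are at
Hausdorff distance at most `δ`. -/
noncomputable def filtrationShift {n : ℕ} {S S' : Finset (Euc n)} (h : S → Euc n)
    (h' : S' → Euc n) {δ : ℝ≥0} (hδ : Metric.hausdorffEDist (graph h) (graph h') ≤ δ) :
    filtration h ⟶ translation (δ : ℝ) ⋙ filtration h' where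
  app r := spanMap (sublevelShift ((hausdorffEDist_domain_le h h').trans hδ) r)
    (sublevelShift hδ r) (sublevelShift ((hausdorffEDist_range_le h h').trans hδ) r) rfl rfl
  naturality _ _ _ := span_hom_ext rfl rfl rfl

/-- All maps involved are inclusions and leave the underlying points unchanged, so equality holds by
definition at each of the three vertices. -/
theorem filtrationShift_comp {n : ℕ} {S S' : Finset (Euc n)} (h : S → Euc n) (h' : S' → Euc n)
    {δ : ℝ≥0} (hδ : Metric.hausdorffEDist (graph h) (graph h') ≤ δ)
    (hδ' : Metric.hausdorffEDist (graph h') (graph h) ≤ δ) (r : ℝ) :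
    (filtrationShift h h' hδ).app r ≫ (filtrationShift h' h hδ').app (r + δ) =
      (filtration h).map
        (homOfLE (show r ≤ r + (δ : ℝ) + (δ : ℝ) by linarith [δ.coe_nonneg])) :=
  span_hom_ext rfl rfl rfl

/-! ### Passage to the `[1,3]`-blocks -/

/-- A shifting morphism between families of representations induces one between their
`[1,3]`-parts. -/
noncomputable def blockShift {K : Type u} [Field K] {P Q : ℝ ⥤ A3Rep K}
    (D : ∀ r, IntervalDecomposition (P.obj r)) (E : ∀ r, IntervalDecomposition (Q.obj r))
    {δ : ℝ} (a : P ⟶ translation δ ⋙ Q) : blockModule P D ⟶ (shift δ).obj (blockModule Q E) where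
  app r := (block13 (D r) (E (r + δ)) (a.app r)).app WalkingSpan.zero
  naturality r s φ := by
    change (block13 (D r) (D s) (P.map φ)).app WalkingSpan.zero ≫
        (block13 (D s) (E (s + δ)) (a.app s)).app WalkingSpan.zero =
      (block13 (D r) (E (r + δ)) (a.app r)).app WalkingSpan.zero ≫
        (block13 (E (r + δ)) (E (s + δ)) (Q.map ((translation δ).map φ))).app WalkingSpan.zero
    -- Both sides become the block of a single composite, and these two composites agree by
    -- naturality of `a`.
    rw [← NatTrans.comp_app, ← NatTrans.comp_app, ← block13_comp, ← block13_comp]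
    exact congrArg (fun ψ => (block13 (D r) (E (s + δ)) ψ).app WalkingSpan.zero) (a.naturality φ)

/-- The intermediate decomposition `E (r + δ)` disappears by `block13_comp`, leaving the block of
the transition map of `P`. Applied with the roles exchanged, this gives the other interleaving
equation. -/
theorem blockShift_comp {K : Type u} [Field K] {P Q : ℝ ⥤ A3Rep K}
    (D : ∀ r, IntervalDecomposition (P.obj r)) (E : ∀ r, IntervalDecomposition (Q.obj r))
    {δ : ℝ≥0} (a : P ⟶ translation (δ : ℝ) ⋙ Q) (b : Q ⟶ translation (δ : ℝ) ⋙ P)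
    (hab : ∀ r, a.app r ≫ b.app (r + δ) =
      P.map (homOfLE (show r ≤ r + (δ : ℝ) + (δ : ℝ) by linarith [δ.coe_nonneg]))) :
    blockShift D E a ≫ (shift (δ : ℝ)).map (blockShift E D b) =
      transition (blockModule P D) δ := by
  ext1
  funext r
  change (block13 (D r) (E (r + δ)) (a.app r)).app WalkingSpan.zero ≫
      (block13 (E (r + δ)) (D (r + δ + δ)) (b.app (r + δ))).app WalkingSpan.zero =
    (block13 (D r) (D (r + δ + δ)) (P.map _)).app WalkingSpan.zero
  rw [← NatTrans.comp_app, ← block13_comp]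
  exact congrArg (fun ψ => (block13 (D r) (D (r + δ + δ)) ψ).app WalkingSpan.zero) (hab r)

/-! ### Interleaving after a functor, and stability -/

/-- The shifting morphism obtained from the shifting inclusions by a functor `H`. -/
noncomputable def homologyFamilyShift {K : Type u} [Field K] (H : TopCat.{0} ⥤ ModuleCat.{u} K)
    {n : ℕ} {S S' : Finset (Euc n)} (h : S → Euc n) (h' : S' → Euc n) {δ : ℝ≥0}
    (hδ : Metric.hausdorffEDist (graph h) (graph h') ≤ δ) :
    homologyFamily H h ⟶ translation (δ : ℝ) ⋙ homologyFamily H h' :=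
  Functor.whiskerRight (filtrationShift h h' hδ)
    ((Functor.whiskeringRight WalkingSpan TopCat.{0} (ModuleCat.{u} K)).obj H)

theorem homologyFamilyShift_comp {K : Type u} [Field K] (H : TopCat.{0} ⥤ ModuleCat.{u} K)
    {n : ℕ} {S S' : Finset (Euc n)} (h : S → Euc n) (h' : S' → Euc n) {δ : ℝ≥0}
    (hδ : Metric.hausdorffEDist (graph h) (graph h') ≤ δ)
    (hδ' : Metric.hausdorffEDist (graph h') (graph h) ≤ δ) (r : ℝ) :
    (homologyFamilyShift H h h' hδ).app r ≫ (homologyFamilyShift H h' h hδ').app (r + δ) =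
      (homologyFamily H h).map
        (homOfLE (show r ≤ r + (δ : ℝ) + (δ : ℝ) by linarith [δ.coe_nonneg])) := by
  let W := (Functor.whiskeringRight WalkingSpan TopCat.{0} (ModuleCat.{u} K)).obj H
  -- The family of representations is the filtration followed by the functor `W`, so the equation is
  -- the image under `W` of the one for spaces.
  change W.map _ ≫ W.map _ = W.map _
  rw [← W.map_comp]
  exact congrArg (fun ψ => W.map ψ) (filtrationShift_comp h h' hδ hδ' r)

/-- Stability of the persistence module of a sampled map, for an arbitrary functor from spaces to
vector spaces in place of homology. -/
theorem interleavingDist_persistenceModule_le {K : Type u} [Field K]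
    (H : TopCat.{0} ⥤ ModuleCat.{u} K) {n : ℕ} {S S' : Finset (Euc n)} (h : S → Euc n)
    (h' : S' → Euc n) (D : ∀ r, IntervalDecomposition ((homologyFamily H h).obj r))
    (D' : ∀ r, IntervalDecomposition ((homologyFamily H h').obj r)) :
    interleavingDist (persistenceModule H h D) (persistenceModule H h' D') ≤
      Metric.hausdorffEDist (graph h) (graph h') := by
  -- The distance is infinite exactly when one of the two finite sets is empty and the other is not;
  -- the bound is then vacuous.
  rcases eq_or_ne (Metric.hausdorffEDist (graph h) (graph h')) ⊤ with htop | htop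
  · rw [htop]
    exact le_top
  lift Metric.hausdorffEDist (graph h) (graph h') to ℝ≥0 using htop with δ hδ
  have h₁ : Metric.hausdorffEDist (graph h) (graph h') ≤ δ := hδ.symm.le
  have h₂ : Metric.hausdorffEDist (graph h') (graph h) ≤ δ := by
    rwa [Metric.hausdorffEDist_comm]
  -- Sublevel sets are defined by a non-strict inequality, so the distance `δ` itself gives an
  -- interleaving and no `ε` of slack is needed.
  exact iInf₂_le δ ⟨blockShift D D' (homologyFamilyShift H h h' h₁),
    blockShift D' D (homologyFamilyShift H h' h h₂),
    blockShift_comp D D' _ _ (homologyFamilyShift_comp H h h' h₁ h₂),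
    blockShift_comp D' D _ _ (homologyFamilyShift_comp H h' h h₂ h₁)⟩

end SampledMap

theorem theorem5p1 {K : Type u} [Field K] {n : ℕ}
    (S S' : Finset (SampledMap.Euc n)) (h : S → SampledMap.Euc n) (h' : S' → SampledMap.Euc n) :
    (∀ (k : ℕ)
      (D : ∀ r, SampledMap.IntervalDecomposition
        ((SampledMap.homologyFamily (SampledMap.homology K k) h).obj r))
      (D' : ∀ r, SampledMap.IntervalDecomposition
        ((SampledMap.homologyFamily (SampledMap.homology K k) h').obj r)),
      SampledMap.interleavingDist
          (SampledMap.persistenceModule (SampledMap.homology K k) h D)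
          (SampledMap.persistenceModule (SampledMap.homology K k) h' D') ≤
        Metric.hausdorffEDist (SampledMap.graph h) (SampledMap.graph h')) ∧
    (∀ (D : ∀ r, SampledMap.IntervalDecomposition
        ((SampledMap.homologyFamily (SampledMap.totalHomology K) h).obj r))
      (D' : ∀ r, SampledMap.IntervalDecomposition
        ((SampledMap.homologyFamily (SampledMap.totalHomology K) h').obj r)),
      SampledMap.interleavingDist
          (SampledMap.persistenceModule (SampledMap.totalHomology K) h D)
          (SampledMap.persistenceModule (SampledMap.totalHomology K) h' D') ≤
        Metric.hausdorffEDist (SampledMap.graph h) (SampledMap.graph h')) := by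
  exact ⟨fun _ D D' => SampledMap.interleavingDist_persistenceModule_le _ h h' D D',
    fun D D' => SampledMap.interleavingDist_persistenceModule_le _ h h' D D'⟩
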